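/- **Theorem (bound on improvement due to lifting).** *Setting.* Let $E$ be $\mathbb{R}^d$ with the metric $|x-y|=\max_i|x_i-y_i|$, or the torus $\mathbb{T}^d=(\mathbb{R}/\mathbb{Z})^d$ with the metric $|x-y|=\max_i \min(|x_i-y_i|,1-|x_i-y_i|)$ (coordinates in $[0,1)$), with Borel $\sigma$-algebra and Lebesgue measure. Let $\Omega\subset E$ be compact, such that every ball centred at a point of $\Omega$ meets $\Omega$ in a set of positive Lebesgue measure. Let $K$ be a Markov transition kernel on $\Omega$ that is reversible with respect to a probability measure $\pi$ on $\Omega$. For $\pi(U)>0$ write $\pi|_U(A)=\pi(U\cap A)/\pi(U)$, and let $\|\mu-\nu\|_{TV}=\sup_A(\mu(A)-\nu(A))$, the supremum being over measurable $A$. *Assumptions.* 1. For every $x\in\Omega$ there are $\alpha_x\in[\tfrac12,1)$, a countable collection $\mathcal{U}_x$ of Borel subsets of $\Omega$ and a probability distribution $\{K_{x,U}\}_{U\in\mathcal{U}_x}$ on $\mathcal{U}_x$ with $$K(x,\cdot)=\alpha_x\delta_x+(1-\alpha_x)\sum_{U\in\mathcal{U}_x}K_{x,U}\,\pi|_U ,$$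 where $x\mapsto\alpha_x$ is measurable, and $\pi_*:=\inf\{\pi(U):\exists x\in\Omega,\ U\in\mathcal{U}_x,\ K_{x,U}>0\}>0$. 2. There are constants $\beta,\gamma\in(0,1]$ such that for all measurable $S\subset\Omega$ with $\pi(S)\le\beta$, $$\int_S(1-\alpha_x)\sum_{U\in\mathcal{U}_x}K_{x,U}\frac{\mathbf 1_U(x)}{\pi(U)}\,\pi(dx)+\sup_{x\in S}\alpha_x\le\gamma .$$ 3. For every $\epsilon>0$ there is $\delta>0$ such that $|x-y|\le\delta$ implies $\|K(x,\cdot)-K(y,\cdot)\|_{TV}\le\min(\alpha_x,\alpha_y)+\epsilon$, for $x,y\in\Omega$. 4. $\pi$ has a density $\rho$ with respect to Lebesgue measure on $\Omega$ that is differentiable on $\Omega$ and satisfies, for some finite constants $C>0$ and $D$, $C^{-1}<\rho(x)<C$ and $|\rho'(x)|<D$ for all $x\in\Omega$. 5. There are $q\in\mathbb{N}$ and $\psi>0$ such that, for every $x\in\Omega$ and $U\in\mathcal{U}_x$ with $K_{x,U}>0$, $U$ is the union of at most $q$ hypercubes of side length at least $\psi$ (intersected with $\Omega$). *Definitions.*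 The mixing time of a kernel $K$ with stationary distribution $\pi$ is $$\tau=\inf\Big\{t\in\{0,1,2,\dots\}:\ \sup_{x}\|K^t(x,\cdot)-\pi\|_{TV}<\tfrac14\Big\}\in[0,\infty].$$ A Markov kernel $\widehat K$ with stationary distribution $\widehat\pi$ on a measurable space $\widehat\Omega$ is a *lift* of $K$ if there is a measurable $f:\widehat\Omega\to\Omega$ such that, for every measurable $S\subset\Omega$ with $\pi(S)>0$: if $\widehat X_0\sim\widehat\pi|_{f^{-1}(S)}$ and $X_0\sim\pi|_S$, and $\widehat X_1$, $X_1$ are obtained from them by one step of $\widehat K$, $K$, then $f(\widehat X_1)$ and $X_1$ have the same distribution. *Conclusion.* For every lift $\widehat K$ of $K$, the mixing times $\widehat\tau$ of $\widehat K$ and $\tau$ of $K$ satisfy $$\widehat\tau\ \ge\ \frac{\sqrt{\gamma}}{16\sqrt{2\log\left(\frac{4}{\pi_*}\right)\log\left(\frac{2}{\sqrt{\beta}}\right)}}\ \sqrt{\tau}.$$ -/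

import Mathlib

open MeasureTheory ProbabilityTheory
open scoped ENNReal

noncomputable section

namespace LiftBound

/-- Total variation distance `sup_A (μ A - ν A)` over measurable sets `A`.  The subtraction is
truncated at `0`, which does not change the supremum since `A = ∅` gives the value `0`. -/
def tv {X : Type*} [MeasurableSpace X] (μ ν : Measure X) : ℝ≥0∞ :=
  ⨆ (A : Set X) (_ : MeasurableSet A), (μ A - ν A)

/-- Mixing profile `inf {t ∈ ℕ : sup_x ‖K^t(x, ·) - π‖_TV < ε}`, equal to `∞` if there is no such
`t`.  Here `K ^ t` is the `t`-step transition kernel, with `K ^ 0` the identity kernel. -/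
def mixingProfile {X : Type*} [MeasurableSpace X] (K : Kernel X X) (π : Measure X)
    (ε : ℝ≥0∞) : ℝ≥0∞ :=
  ⨅ (t : ℕ) (_ : (⨆ x : X, tv ((K ^ t) x) π) < ε), (t : ℝ≥0∞)

/-- The mixing time is the mixing profile at `1/4`. -/
def mixingTime {X : Type*} [MeasurableSpace X] (K : Kernel X X) (π : Measure X) : ℝ≥0∞ :=
  mixingProfile K π (1 / 4)

/-- `K'`, with stationary measure `π'`, is a lift of `K`, with stationary measure `π`: for some
measurable `f` and every measurable `S` with `π S > 0`, if `X'₀` has law `π'` renormalized on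
`f ⁻¹' S` and `X₀` has law `π` renormalized on `S`, then `f X'₁` and `X₁` have the same law. -/
def IsLift {X Y : Type*} [MeasurableSpace X] [MeasurableSpace Y]
    (K' : Kernel Y Y) (π' : Measure Y) (K : Kernel X X) (π : Measure X) : Prop :=
  ∃ f : Y → X, Measurable f ∧ ∀ S : Set X, MeasurableSet S → 0 < π S →
    ((cond π' (f ⁻¹' S)).bind K').map f = (cond π S).bind K

/-- A representation
`K(x, ·) = α_x δ_x + (1 - α_x) ∑_{U ∈ 𝒰_x} w_{x,U} π|_U` of a kernel, where `α_x ∈ [1/2, 1)` is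
measurable in `x`, the `𝒰_x` are countable collections of measurable sets, and `w_x` is a
probability distribution on `𝒰_x`. -/
structure LazyRep {X : Type*} [MeasurableSpace X] (K : Kernel X X) (π : Measure X) where
  α : X → ℝ
  measurable_α : Measurable α
  half_le_α : ∀ x, 1 / 2 ≤ α x
  α_lt_one : ∀ x, α x < 1
  𝒰 : X → Set (Set X)
  countable_𝒰 : ∀ x, (𝒰 x).Countable
  measurableSet_𝒰 : ∀ x, ∀ U ∈ 𝒰 x, MeasurableSet U
  w : X → Set X → ℝ≥0∞
  sum_w : ∀ x, ∑' U : 𝒰 x, w x U = 1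
  kernel_eq : ∀ x, K x = ENNReal.ofReal (α x) • Measure.dirac x +
    ENNReal.ofReal (1 - α x) • Measure.sum (fun U : 𝒰 x => w x U • cond π (U : Set X))

/-- `π_* = inf {π U : ∃ x, U ∈ 𝒰_x and w_{x,U} > 0}`. -/
def LazyRep.piStar {X : Type*} [MeasurableSpace X] {K : Kernel X X} {π : Measure X}
    (R : LazyRep K π) : ℝ≥0∞ :=
  sInf {r | ∃ x : X, ∃ U ∈ R.𝒰 x, 0 < R.w x U ∧ r = π U}

/-- The density with respect to `π`, at the point `x` itself, of
`(1 - α_x) ∑_{U ∈ 𝒰_x} w_{x,U} π|_U`; recall that `π|_U (dy) = 1_U(y) / π(U) π(dy)`. -/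
def LazyRep.diagDensity {X : Type*} [MeasurableSpace X] {K : Kernel X X} {π : Measure X}
    (R : LazyRep K π) (x : X) : ℝ≥0∞ :=
  ENNReal.ofReal (1 - R.α x) *
    ∑' U : R.𝒰 x, R.w x U * (U : Set X).indicator (fun _ => (π (U : Set X))⁻¹) x

/-- A hypercube of side length at least `ψ` in `ℝ^d`: a product of `d` intervals (each containing
or not its end points) of the same length `s ≥ ψ`. -/
def IsHypercube {d : ℕ} (ψ : ℝ) (C : Set (Fin d → ℝ)) : Prop :=
  ∃ (s : ℝ) (a : Fin d → ℝ) (I : Fin d → Set ℝ), ψ ≤ s ∧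
    (∀ i, Set.Ioo (a i) (a i + s) ⊆ I i ∧ I i ⊆ Set.Icc (a i) (a i + s)) ∧
    C = Set.univ.pi I

/-- The assumptions on a kernel on a subset `Ω` of a space `E`, where `E` is either `ℝ^d` or the
torus `𝕋^d`, and `p : ℝ^d → E` is the identity or the canonical projection.  Hypercubes in `E` are
the images under `p` of hypercubes in `ℝ^d`, and functions on `E` are differentiated after
composition with `p`. -/
structure Assumptions {d : ℕ} {E : Type*} [MetricSpace E] [MeasureSpace E]
    (p : (Fin d → ℝ) → E) (Ω : Set E) (π : Measure Ω) (K : Kernel Ω Ω) (R : LazyRep K π)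
    (β γ : ℝ) : Prop where
  reversible : K.IsReversible π
  piStar_pos : 0 < R.piStar
  β_pos : 0 < β
  β_le_one : β ≤ 1
  γ_pos : 0 < γ
  γ_le_one : γ ≤ 1
  minorization : ∀ S : Set Ω, MeasurableSet S → π S ≤ ENNReal.ofReal β →
    (∫⁻ x in S, R.diagDensity x ∂π) + (⨆ x ∈ S, ENNReal.ofReal (R.α x)) ≤ ENNReal.ofReal γ
  tv_cont : ∀ ε : ℝ, 0 < ε → ∃ δ : ℝ, 0 < δ ∧ ∀ x y : Ω, dist x y ≤ δ →
    tv (K x) (K y) ≤ ENNReal.ofReal (min (R.α x) (R.α y) + ε)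
  density : ∃ ρ : E → ℝ,
    π.map Subtype.val = (volume.restrict Ω).withDensity (fun x => ENNReal.ofReal (ρ x)) ∧
    (∃ C : ℝ, 0 < C ∧ ∀ x ∈ Ω, C⁻¹ < ρ x ∧ ρ x < C) ∧
    (∃ D : ℝ, ∀ y ∈ p ⁻¹' Ω, ∃ ρ' : (Fin d → ℝ) →L[ℝ] ℝ,
      HasFDerivWithinAt (ρ ∘ p) ρ' (p ⁻¹' Ω) y ∧ ‖ρ'‖ < D)
  cubes : ∃ (q : ℕ) (ψ : ℝ), 0 < ψ ∧ ∀ x : Ω, ∀ U ∈ R.𝒰 x, 0 < R.w x U →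
    ∃ F : Finset (Set (Fin d → ℝ)), F.card ≤ q ∧ (∀ C ∈ F, IsHypercube ψ C) ∧
      U = Subtype.val ⁻¹' (⋃ C ∈ F, p '' C)

/-- The constant `√γ / (16 √(2 log(4/π_*) log(2/√β)))`. -/
def liftConst (πstar β γ : ℝ) : ℝ :=
  √γ / (16 * √(2 * Real.log (4 / πstar) * Real.log (2 / √β)))

end LiftBound

end

/-! Suppose the lift mixes within `T` steps. From any starting point it then sits, at time `T`,
outside the preimage of a set `S` with `π S ≤ 1/2` with probability at least 1/4. In stationarity
the probability of having left by time `T` is at most `T` times the one-step flow, and a lift has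
the same one-step flows between preimages as `K` has between sets. Hence `K` has expansion `c =
1/(4T)` (`measure_le_flow_of_isLift`).

The converse bound on `τ` is Cheeger's inequality plus a warm start. Expansion `c` gives a Poincaré
inequality (`HasExpansion.cheeger`), and laziness turns it into a contraction of mean-zero functions
in L² by the factor `1 - c²/8` in squared norm (`contraction`). This controls averages over starting
laws with bounded density, whereas `K^n(x, ·)` keeps an atom of mass about `α_x^n`. The rest of its
mass has density at most `1/π_*` (`LazyRep.pow_le`). The atom dies out because expansion forces `α_x
≤ 1 - c`: by total variation continuity a small ball around `x` would otherwise have too little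
outflow (`LazyRep.α_le`).

So `16T` steps shrink the atom to 1/16, and about `256 T² log(4/π_*)` more make the rest negligible.
Thus `τ` is at most of order `T² log(4/π_*)`; the stated constant follows from `√γ ≤ 1` and
`log(2/√β) ≥ log 2`. -/

namespace LiftBound

/-! ### Cheeger's inequality for a flow with expansion. -/

section Isoperimetry

variable {X : Type*} [MeasurableSpace X]

theorem integrable_of_abs_le {μ : Measure X} [IsFiniteMeasure μ] {g : X → ℝ} (hg : Measurable g)
    {b : ℝ} (hb : ∀ x, |g x| ≤ b) : Integrable g μ :=
  Integrable.of_bound hg.aestronglyMeasurable b (ae_of_all _ hb)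

/-- The supremum of the levels `t` with `π {g < t} ≤ 1/2` is a median: approximate it by strictly
monotone sequences from above and from below. -/
theorem exists_median (π : Measure X) [IsProbabilityMeasure π] {g : X → ℝ} (hg : Measurable g)
    {b : ℝ} (hb : ∀ x, |g x| ≤ b) :
    ∃ m, |m| ≤ b ∧ π {x | m < g x} ≤ 1 / 2 ∧ π {x | g x < m} ≤ 1 / 2 := by
  have hne : Nonempty X := by
    by_contra h
    rw [not_nonempty_iff] at h
    have := measure_univ (μ := π)
    simp [Measure.eq_zero_of_isEmpty π] at this
  set A : Set ℝ := {t | π {x | g x < t} ≤ 1 / 2} with hA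
  have hle : ∀ t ∈ A, t ≤ b := by
    intro t ht
    by_contra! h
    have : {x | g x < t} = Set.univ := by
      ext x; simp; linarith [(abs_le.1 (hb x)).2]
    rw [hA, Set.mem_ofPred_eq, this, measure_univ] at ht
    norm_num at ht
  have hmem : -b ∈ A := by
    have : {x | g x < -b} = ∅ := by
      ext x; simp; linarith [(abs_le.1 (hb x)).1]
    simp [hA, this]
  have hbdd : BddAbove A := ⟨b, hle⟩
  refine ⟨sSup A, abs_le.2 ⟨le_csSup hbdd hmem, csSup_le ⟨_, hmem⟩ hle⟩, ?_, ?_⟩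
  · obtain ⟨v, hanti, hv, hvt⟩ := exists_seq_strictAnti_tendsto (sSup A)
    have hU : {x | sSup A < g x} = ⋃ n, {x | v n ≤ g x} := by
      ext x
      simp only [Set.mem_ofPred_eq, Set.mem_iUnion]
      refine ⟨fun h => ?_, fun ⟨n, hn⟩ => (hv n).trans_le hn⟩
      obtain ⟨n, hn⟩ := (hvt.eventually (gt_mem_nhds h)).exists
      exact ⟨n, hn.le⟩
    rw [hU, Directed.measure_iUnion]
    · refine iSup_le fun n => ?_
      have h1 : v n ∉ A := fun h => (le_csSup hbdd h).not_gt (hv n)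
      have h2 : {x | v n ≤ g x} = {x | g x < v n}ᶜ := by ext x; simp
      rw [h2, prob_compl_eq_one_sub (measurableSet_lt hg measurable_const)]
      rw [hA, Set.mem_ofPred_eq, not_le] at h1
      refine (tsub_le_tsub_left h1.le 1).trans ?_
      simp
    · refine directed_of_isDirected_le ?_
      intro i j hij x hx
      exact (hanti.antitone hij).trans hx
  · obtain ⟨v, hmono, hv, hvt⟩ := exists_seq_strictMono_tendsto (sSup A)
    have hU : {x | g x < sSup A} = ⋃ n, {x | g x < v n} := by
      ext x
      simp only [Set.mem_ofPred_eq, Set.mem_iUnion]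
      refine ⟨fun h => ?_, fun ⟨n, hn⟩ => hn.trans (hv n)⟩
      exact (hvt.eventually (lt_mem_nhds h)).exists
    rw [hU, Directed.measure_iUnion]
    · refine iSup_le fun n => ?_
      obtain ⟨t, ht, hvt⟩ := exists_lt_of_lt_csSup ⟨_, hmem⟩ (hv n)
      refine le_trans (measure_mono ?_) ht
      intro x hx
      exact lt_trans hx hvt
    · refine directed_of_isDirected_le ?_
      intro i j hij x hx
      exact lt_of_lt_of_le hx (hmono.monotone hij)

/-- `Q` is a flow whose boundary of every set of `π`-measure at most `1 / 2` is at least `c` times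
the measure of the set. -/
def HasExpansion (Q : Measure (X × X)) (π : Measure X) (c : ℝ) : Prop :=
  ∀ S : Set X, MeasurableSet S → π S ≤ 1 / 2 → ENNReal.ofReal c * π S ≤ Q (S ×ˢ Sᶜ)

/-- Co-area argument: every superlevel set of `f` at a positive level has measure at most 1/2, so
expansion applies to it; then integrate over the levels. Tonelli on the region `f z.2 ≤ s < f z.1`
turns the integrated boundary flow into the right-hand side. -/
theorem HasExpansion.lintegral_le {Q : Measure (X × X)} [IsFiniteMeasure Q] {π : Measure X}
    {c : ℝ} (h : HasExpansion Q π c) {f : X → ℝ} (hf : Measurable f) (hf0 : ∀ x, 0 ≤ f x)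
    (hs : π {x | 0 < f x} ≤ 1 / 2) :
    ENNReal.ofReal c * ∫⁻ x, ENNReal.ofReal (f x) ∂π ≤
      ∫⁻ z, ENNReal.ofReal (f z.1 - f z.2) ∂Q := by
  set W : Set ((X × X) × ℝ) := {w | f w.1.2 ≤ w.2 ∧ w.2 < f w.1.1} with hW
  have hWm : MeasurableSet W :=
    (measurableSet_le (hf.comp (measurable_snd.comp measurable_fst)) measurable_snd).inter
      (measurableSet_lt measurable_snd (hf.comp (measurable_fst.comp measurable_fst)))
  have h1 : (Q.prod volume) W = ∫⁻ z, ENNReal.ofReal (f z.1 - f z.2) ∂Q := by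
    rw [Measure.prod_apply hWm]
    refine lintegral_congr fun z => ?_
    have : Prod.mk z ⁻¹' W = Set.Ico (f z.2) (f z.1) := rfl
    rw [this, Real.volume_Ico]
  have h2 : (Q.prod volume) W = ∫⁻ s, Q ({x | s < f x} ×ˢ {x | s < f x}ᶜ) := by
    rw [Measure.prod_apply_symm hWm]
    refine lintegral_congr fun s => congrArg Q ?_
    ext z
    simp [hW, and_comm]
  rw [← h1, h2, lintegral_eq_lintegral_meas_lt π (ae_of_all _ hf0) hf.aemeasurable,
    ← lintegral_const_mul' _ _ ENNReal.ofReal_ne_top]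
  refine le_trans (setLIntegral_mono' measurableSet_Ioi fun s hs' => ?_)
    (setLIntegral_le_lintegral (Set.Ioi 0) _)
  refine h _ (measurableSet_lt measurable_const hf) (le_trans (measure_mono ?_) hs)
  intro x hx
  rw [Set.mem_ofPred_eq] at hx ⊢
  exact lt_trans (Set.mem_Ioi.1 hs') hx

/-- Apply the co-area bound to `f²`, factor `f(x)² - f(y)²` as a difference times a sum, and split
the product by weighted AM-GM so that the part with the sum is absorbed on the left. -/
theorem HasExpansion.cheeger_nonneg {Q : Measure (X × X)} [IsFiniteMeasure Q] {π : Measure X}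
    (hQ1 : Q.map Prod.fst = π) (hQ2 : Q.map Prod.snd = π)
    {c : ℝ} (hc : 0 < c) (h : HasExpansion Q π c) {f : X → ℝ} (hf : Measurable f)
    (hf0 : ∀ x, 0 ≤ f x) {b : ℝ} (hb : ∀ x, f x ≤ b) (hs : π {x | 0 < f x} ≤ 1 / 2) :
    c ^ 2 / 4 * ∫ x, f x ^ 2 ∂π ≤ ∫ z, (f z.1 - f z.2) ^ 2 ∂Q := by
  have : IsFiniteMeasure π := hQ1 ▸ inferInstance
  have hb2 : ∀ x, f x ^ 2 ≤ b ^ 2 := fun x => pow_le_pow_left₀ (hf0 x) (hb x) 2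
  have key := h.lintegral_le (f := fun x => f x ^ 2) (hf.pow_const 2) (fun x => sq_nonneg _)
    (le_trans (measure_mono fun x hx => (hf0 x).lt_of_ne fun h0 => by simp [← h0] at hx) hs)
  have hf1 : Measurable fun z : X × X => f z.1 := hf.comp measurable_fst
  have hf2 : Measurable fun z : X × X => f z.2 := hf.comp measurable_snd
  have i1 : Integrable (fun x => f x ^ 2) π :=
    integrable_of_abs_le (hf.pow_const 2) fun x => by rw [abs_of_nonneg (sq_nonneg _)]; exact hb2 x
  have j1 : Integrable (fun z : X × X => f z.1 ^ 2) Q :=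
    integrable_of_abs_le (hf1.pow_const 2) fun x => by
      rw [abs_of_nonneg (sq_nonneg _)]; exact hb2 _
  have j2 : Integrable (fun z : X × X => f z.2 ^ 2) Q :=
    integrable_of_abs_le (hf2.pow_const 2) fun x => by
      rw [abs_of_nonneg (sq_nonneg _)]; exact hb2 _
  have j3 : Integrable (fun z : X × X => (f z.1 - f z.2) ^ 2) Q :=
    integrable_of_abs_le ((hf1.sub hf2).pow_const 2) (b := 2 * b ^ 2) fun z => by
      rw [abs_of_nonneg (sq_nonneg _)]
      nlinarith [hb2 z.1, hb2 z.2, mul_nonneg (hf0 z.1) (hf0 z.2), sq_nonneg b]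
  have e1 : ∫ z, f z.1 ^ 2 ∂Q = ∫ x, f x ^ 2 ∂π := by
    conv_rhs => rw [← hQ1]
    rw [integral_map measurable_fst.aemeasurable (hf.pow_const 2).aestronglyMeasurable]
  have e2 : ∫ z, f z.2 ^ 2 ∂Q = ∫ x, f x ^ 2 ∂π := by
    conv_rhs => rw [← hQ2]
    rw [integral_map measurable_snd.aemeasurable (hf.pow_const 2).aestronglyMeasurable]
  -- The weights are chosen so that the second term integrates to `(c/2) ∫ f²`, half of the
  -- left-hand side of the co-area bound.
  set G : X × X → ℝ := fun z => 2 / c * (f z.1 - f z.2) ^ 2 + c / 4 * (f z.1 ^ 2 + f z.2 ^ 2)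
    with hG
  have hG0 : ∀ z, 0 ≤ G z := fun z => by simp only [hG]; positivity
  have jG : Integrable G Q := (j3.const_mul _).add ((j1.add j2).const_mul _)
  have hle : ∀ z : X × X, f z.1 ^ 2 - f z.2 ^ 2 ≤ G z := by
    intro z
    have h0 : 0 ≤ (4 * (f z.1 - f z.2) - c * (f z.1 + f z.2)) ^ 2 / (8 * c) := by positivity
    have h1 : 0 ≤ c / 8 * (f z.1 - f z.2) ^ 2 := by positivity
    have h2 : (4 * (f z.1 - f z.2) - c * (f z.1 + f z.2)) ^ 2 / (8 * c) =
      2 / c * (f z.1 - f z.2) ^ 2 - (f z.1 ^ 2 - f z.2 ^ 2) + c / 8 * (f z.1 + f z.2) ^ 2 := by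
      field_simp; ring
    simp only [hG]
    nlinarith
  have key2 : c * ∫ x, f x ^ 2 ∂π ≤ ∫ z, G z ∂Q := by
    have h3 := key.trans (lintegral_mono fun z => ENNReal.ofReal_le_ofReal (hle z))
    rw [← ofReal_integral_eq_lintegral_ofReal i1 (ae_of_all _ fun x => sq_nonneg _),
      ← ofReal_integral_eq_lintegral_ofReal jG (ae_of_all _ hG0), ← ENNReal.ofReal_mul hc.le,
      ENNReal.ofReal_le_ofReal_iff (integral_nonneg hG0)] at h3
    exact h3
  have eG : ∫ z, G z ∂Q = 2 / c * ∫ z, (f z.1 - f z.2) ^ 2 ∂Q + c / 2 * ∫ x, f x ^ 2 ∂π := by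
    simp only [hG]
    have j4 : Integrable (fun z : X × X => c / 4 * (f z.1 ^ 2 + f z.2 ^ 2)) Q :=
      (j1.add j2).const_mul _
    rw [integral_add (j3.const_mul _) j4, integral_const_mul,
      integral_const_mul, integral_add j1 j2, e1, e2]
    ring
  rw [eG] at key2
  have h4 : c / 2 * ∫ x, f x ^ 2 ∂π ≤ 2 / c * ∫ z, (f z.1 - f z.2) ^ 2 ∂Q := by linarith
  have h5 := mul_le_mul_of_nonneg_left h4 (by positivity : 0 ≤ c / 2)
  have h6 : c / 2 * (2 / c * ∫ z, (f z.1 - f z.2) ^ 2 ∂Q) = ∫ z, (f z.1 - f z.2) ^ 2 ∂Q := by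
    field_simp
  rw [h6] at h5
  linarith

/-- Cut `g` at a median `m`: the positive and negative parts of `g - m` each have support of measure
at most 1/2. Since `g` has mean zero, subtracting `m` does not decrease its L² norm; since the two
parts have disjoint supports, their energies add up to at most that of `g`. -/
theorem HasExpansion.cheeger {Q : Measure (X × X)} {π : Measure X} [IsFiniteMeasure Q]
    [IsProbabilityMeasure π] (hQ1 : Q.map Prod.fst = π) (hQ2 : Q.map Prod.snd = π)
    {c : ℝ} (hc : 0 < c) (h : HasExpansion Q π c) {g : X → ℝ} (hg : Measurable g)
    {b : ℝ} (hb : ∀ x, |g x| ≤ b) (hg0 : ∫ x, g x ∂π = 0) :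
    c ^ 2 / 4 * ∫ x, g x ^ 2 ∂π ≤ ∫ z, (g z.1 - g z.2) ^ 2 ∂Q := by
  obtain ⟨m, hmb, hm1, hm2⟩ := exists_median π hg hb
  have hb' := fun x => abs_le.1 (hb x)
  have hmb' := abs_le.1 hmb
  set p : X → ℝ := fun x => max (g x - m) 0 with hp
  set n : X → ℝ := fun x => max (m - g x) 0 with hn
  have hpm : Measurable p := (hg.sub_const m).max measurable_const
  have hnm : Measurable n := (hg.const_sub m).max measurable_const
  have hp0 : ∀ x, 0 ≤ p x := fun x => le_max_right _ _
  have hn0 : ∀ x, 0 ≤ n x := fun x => le_max_right _ _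
  have hpb : ∀ x, p x ≤ 2 * b := fun x => max_le (by linarith [hb' x]) (by linarith [hb' x])
  have hnb : ∀ x, n x ≤ 2 * b := fun x => max_le (by linarith [hb' x]) (by linarith [hb' x])
  have cp := h.cheeger_nonneg hQ1 hQ2 hc hpm hp0 hpb (by simpa [hp] using hm1)
  have cn := h.cheeger_nonneg hQ1 hQ2 hc hnm hn0 hnb (by simpa [hn] using hm2)
  have hsq : ∀ f : X → ℝ, Measurable f → (∀ x, 0 ≤ f x) → (∀ x, f x ≤ 2 * b) →
      Integrable (fun x => f x ^ 2) π := fun f hf h0 h1 =>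
    integrable_of_abs_le (hf.pow_const 2) (b := (2 * b) ^ 2) fun x => by
      rw [abs_of_nonneg (sq_nonneg _)]; exact pow_le_pow_left₀ (h0 x) (h1 x) 2
  have hsq2 : ∀ f : X → ℝ, Measurable f → (∀ x, |f x| ≤ 2 * b) →
      Integrable (fun z : X × X => (f z.1 - f z.2) ^ 2) Q := fun f hf h0 =>
    integrable_of_abs_le (((hf.comp measurable_fst).sub (hf.comp measurable_snd)).pow_const 2)
      (b := (4 * b) ^ 2) fun z => by
        rw [abs_of_nonneg (sq_nonneg _), ← sq_abs]
        refine pow_le_pow_left₀ (abs_nonneg _) ((abs_sub _ _).trans ?_) 2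
        linarith [h0 z.1, h0 z.2]
  have ig : Integrable g π := integrable_of_abs_le hg hb
  have ig2 : Integrable (fun x => g x ^ 2) π := integrable_of_abs_le (hg.pow_const 2) (b := b ^ 2)
    fun x => by
      rw [abs_of_nonneg (sq_nonneg _), ← sq_abs]
      exact pow_le_pow_left₀ (abs_nonneg _) (hb x) 2
  have l1 : ∫ x, g x ^ 2 ∂π ≤ ∫ x, p x ^ 2 ∂π + ∫ x, n x ^ 2 ∂π := by
    have i3 : Integrable (fun x => g x ^ 2 - 2 * m * g x) π := ig2.sub (ig.const_mul _)
    have e : ∫ x, (g x ^ 2 - 2 * m * g x + m ^ 2) ∂π = ∫ x, g x ^ 2 ∂π + m ^ 2 := by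
      rw [integral_add i3 (integrable_const _),
        integral_sub ig2 (ig.const_mul _), integral_const_mul, hg0]
      simp
    rw [← integral_add (hsq p hpm hp0 hpb) (hsq n hnm hn0 hnb)]
    have e2 : ∀ x, p x ^ 2 + n x ^ 2 = g x ^ 2 - 2 * m * g x + m ^ 2 := by
      intro x
      simp only [hp, hn]
      rcases le_total (g x) m with hx | hx
      · rw [max_eq_right (by linarith), max_eq_left (by linarith)]; ring
      · rw [max_eq_left (by linarith), max_eq_right (by linarith)]; ring
    simp only [e2, e]
    nlinarith [sq_nonneg m]
  have l2 : ∫ z, (p z.1 - p z.2) ^ 2 ∂Q + ∫ z, (n z.1 - n z.2) ^ 2 ∂Q ≤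
      ∫ z, (g z.1 - g z.2) ^ 2 ∂Q := by
    have ap : ∀ x, |p x| ≤ 2 * b := fun x => by rw [abs_of_nonneg (hp0 x)]; exact hpb x
    have an : ∀ x, |n x| ≤ 2 * b := fun x => by rw [abs_of_nonneg (hn0 x)]; exact hnb x
    have ag : ∀ x, |g x| ≤ 2 * b := fun x => by linarith [hb x, abs_nonneg (g x)]
    rw [← integral_add (hsq2 p hpm ap) (hsq2 n hnm an)]
    refine integral_mono ((hsq2 p hpm ap).add (hsq2 n hnm an)) (hsq2 g hg ag) fun z => ?_
    have e : ∀ x, g x = m + p x - n x ∧ p x * n x = 0 := by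
      intro x
      simp only [hp, hn]
      rcases le_total (g x) m with hx | hx
      · rw [max_eq_right (by linarith), max_eq_left (by linarith)]; constructor <;> ring
      · rw [max_eq_left (by linarith), max_eq_right (by linarith)]; constructor <;> ring
    obtain ⟨e1, e1'⟩ := e z.1
    obtain ⟨e2, e2'⟩ := e z.2
    simp only [e1, e2]
    nlinarith [mul_nonneg (hp0 z.1) (hn0 z.2), mul_nonneg (hp0 z.2) (hn0 z.1)]
  have hc2 : 0 ≤ c ^ 2 / 4 := by positivity
  nlinarith [mul_le_mul_of_nonneg_left l1 hc2]

end Isoperimetry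

/-! ### L² contraction of lazy chains and total variation from a warm start. -/

section Contraction

variable {X : Type*} [MeasurableSpace X]

/-- A kernel that holds its position with probability at least `1 / 2`. -/
def IsLazy (K : Kernel X X) : Prop :=
  ∀ x, ∃ (a : ℝ) (ν : Measure X), IsProbabilityMeasure ν ∧ 1 / 2 ≤ a ∧ a ≤ 1 ∧
    K x = ENNReal.ofReal a • Measure.dirac x + ENNReal.ofReal (1 - a) • ν

theorem sq_integral_le_integral_sq {μ : Measure X} [IsProbabilityMeasure μ] {g : X → ℝ}
    (hg : Measurable g) {b : ℝ} (hb : ∀ x, |g x| ≤ b) :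
    (∫ x, g x ∂μ) ^ 2 ≤ ∫ x, g x ^ 2 ∂μ := by
  have i1 : Integrable g μ := integrable_of_abs_le hg hb
  have i2 : Integrable (fun x => g x ^ 2) μ := integrable_of_abs_le (hg.pow_const 2) (b := b ^ 2)
    fun x => by
      rw [abs_of_nonneg (sq_nonneg _), ← sq_abs]
      exact pow_le_pow_left₀ (abs_nonneg _) (hb x) 2
  set m := ∫ x, g x ∂μ with hm
  have i3 : Integrable (fun x => g x ^ 2 - 2 * m * g x) μ := i2.sub (i1.const_mul _)
  have e : ∫ x, (g x ^ 2 - 2 * m * g x + m ^ 2) ∂μ = ∫ x, g x ^ 2 ∂μ - m ^ 2 := by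
    rw [integral_add i3 (integrable_const _), integral_sub i2 (i1.const_mul _),
      integral_const_mul, ← hm]
    simp
    ring
  have h0 : 0 ≤ ∫ x, (g x ^ 2 - 2 * m * g x + m ^ 2) ∂μ :=
    integral_nonneg fun x => by
      have : g x ^ 2 - 2 * m * g x + m ^ 2 = (g x - m) ^ 2 := by ring
      simp only [this]
      positivity
  linarith

/-- The holding part contributes nothing, so Jensen's inequality for `ν` leaves the factor `(1 - a)²
≤ (1 - a)/2`. -/
theorem IsLazy.sq_sub_le {K : Kernel X X} (h : IsLazy K) {g : X → ℝ} (hg : Measurable g)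
    {b : ℝ} (hb : ∀ x, |g x| ≤ b) (x : X) :
    (∫ y, (g y - g x) ∂K x) ^ 2 ≤ 1 / 2 * ∫ y, (g y - g x) ^ 2 ∂K x := by
  obtain ⟨a, ν, hν, ha, ha1, hK⟩ := h x
  have hm : Measurable fun y => g y - g x := hg.sub_const _
  have hmb : ∀ y, |g y - g x| ≤ 2 * b := fun y =>
    (abs_sub _ _).trans (by linarith [hb x, hb y])
  have hm2 : Measurable fun y => (g y - g x) ^ 2 := hm.pow_const 2
  have hmb2 : ∀ y, |(g y - g x) ^ 2| ≤ (2 * b) ^ 2 := fun y => by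
    rw [abs_pow]; exact pow_le_pow_left₀ (abs_nonneg _) (hmb y) 2
  have key : ∀ f : X → ℝ, Measurable f → ∀ c : ℝ, (∀ y, |f y| ≤ c) → f x = 0 →
      ∫ y, f y ∂K x = (1 - a) * ∫ y, f y ∂ν := by
    intro f hf c hc h0
    rw [hK, integral_add_measure, integral_smul_measure, integral_smul_measure,
      integral_dirac' _ _ hf.stronglyMeasurable, h0, ENNReal.toReal_ofReal (by linarith)]
    · simp [ha1]
    · exact (integrable_of_abs_le hf hc).smul_measure ENNReal.ofReal_ne_top
    · exact (integrable_of_abs_le hf hc).smul_measure ENNReal.ofReal_ne_top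
  rw [key _ hm _ hmb (by simp), key _ hm2 _ hmb2 (by simp), mul_pow]
  have h1 := sq_integral_le_integral_sq (μ := ν) hm hmb
  have h2 : 0 ≤ ∫ y, (g y - g x) ^ 2 ∂ν := integral_nonneg fun y => sq_nonneg _
  have h3 : (1 - a) ^ 2 ≤ 1 / 2 * (1 - a) := by nlinarith
  calc (1 - a) ^ 2 * (∫ y, (g y - g x) ∂ν) ^ 2 ≤ (1 - a) ^ 2 * ∫ y, (g y - g x) ^ 2 ∂ν := by
        gcongr
    _ ≤ 1 / 2 * (1 - a) * ∫ y, (g y - g x) ^ 2 ∂ν := by gcongr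
    _ = _ := by ring

theorem measurable_kernel_integral (K : Kernel X X) [IsMarkovKernel K] {g : X → ℝ}
    (hg : Measurable g) : Measurable fun x => ∫ y, g y ∂K x :=
  (hg.stronglyMeasurable.integral_kernel (κ := K)).measurable

theorem abs_integral_le_of_abs_le {μ : Measure X} [IsProbabilityMeasure μ] {g : X → ℝ}
    {b : ℝ} (hb : ∀ x, |g x| ≤ b) : |∫ y, g y ∂μ| ≤ b := by
  have := norm_integral_le_of_norm_le_const (μ := μ) (f := g) (C := b) (ae_of_all _ hb)
  simpa using this

theorem integral_kernel_integral {K : Kernel X X} [IsMarkovKernel K] {π : Measure X}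
    [IsProbabilityMeasure π] (hK : K.Invariant π) {g : X → ℝ} (hg : Measurable g) {b : ℝ}
    (hb : ∀ x, |g x| ≤ b) : ∫ x, ∫ y, g y ∂K x ∂π = ∫ x, g x ∂π := by
  have hsnd : (π ⊗ₘ K).map Prod.snd = π := (Measure.snd_compProd π K).trans hK
  conv_rhs => rw [← hsnd]
  rw [integral_map measurable_snd.aemeasurable hg.aestronglyMeasurable, Measure.integral_compProd]
  exact integrable_of_abs_le (hg.comp measurable_snd) fun z => hb z.2

/-- Let `D` be the integral of `(g x - g y)²` over the flow; invariance gives `D = 2‖g‖² - 2⟨g,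
Kg⟩`. Laziness gives `‖Kg - g‖² ≤ D/2`, that is `‖Kg‖² ≤ ⟨g, Kg⟩ = ‖g‖² - D/2`, and Cheeger bounds
`D` below by `(c²/4)‖g‖²`. -/
theorem contraction {K : Kernel X X} [IsMarkovKernel K] {π : Measure X} [IsProbabilityMeasure π]
    (hK : K.Invariant π) (hlazy : IsLazy K) {c : ℝ} (hc : 0 < c)
    (hexp : HasExpansion (π ⊗ₘ K) π c) {g : X → ℝ} (hg : Measurable g) {b : ℝ}
    (hb : ∀ x, |g x| ≤ b) (hg0 : ∫ x, g x ∂π = 0) :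
    ∫ x, (∫ y, g y ∂K x) ^ 2 ∂π ≤ (1 - c ^ 2 / 8) * ∫ x, g x ^ 2 ∂π := by
  have hg2 : Measurable fun x => g x ^ 2 := hg.pow_const 2
  have hb2 : ∀ x, |g x ^ 2| ≤ b ^ 2 := fun x => by
    rw [abs_pow]; exact pow_le_pow_left₀ (abs_nonneg _) (hb x) 2
  set k : X → ℝ := fun x => ∫ y, g y ∂K x with hk
  set k2 : X → ℝ := fun x => ∫ y, g y ^ 2 ∂K x with hk2
  have mk : Measurable k := measurable_kernel_integral K hg
  have mk2 : Measurable k2 := measurable_kernel_integral K hg2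
  have bk : ∀ x, |k x| ≤ b := fun x => abs_integral_le_of_abs_le hb
  have bk2 : ∀ x, |k2 x| ≤ b ^ 2 := fun x => abs_integral_le_of_abs_le hb2
  have ik2 : ∫ x, k2 x ∂π = ∫ x, g x ^ 2 ∂π := integral_kernel_integral hK hg2 hb2
  have h1 : ∀ x, ∫ y, (g y - g x) ∂K x = k x - g x := fun x => by
    rw [integral_sub (integrable_of_abs_le hg hb) (integrable_const _)]
    simp [hk]
  have h2 : ∀ x, ∫ y, (g x - g y) ^ 2 ∂K x = k2 x - 2 * g x * k x + g x ^ 2 := fun x => by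
    have i1 : Integrable (fun y => g y ^ 2) (K x) := integrable_of_abs_le hg2 hb2
    have i2 : Integrable (fun y => 2 * g x * g y) (K x) :=
      (integrable_of_abs_le hg hb).const_mul _
    have i3 : Integrable (fun y => g y ^ 2 - 2 * g x * g y) (K x) := i1.sub i2
    have : ∀ y, (g x - g y) ^ 2 = g y ^ 2 - 2 * g x * g y + g x ^ 2 := fun y => by ring
    simp only [this]
    rw [integral_add i3 (integrable_const _), integral_sub i1 i2, integral_const_mul]
    simp [hk, hk2]
  have hmQ : Measurable fun z : X × X => (g z.1 - g z.2) ^ 2 :=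
    ((hg.comp measurable_fst).sub (hg.comp measurable_snd)).pow_const 2
  have hD : ∫ z, (g z.1 - g z.2) ^ 2 ∂(π ⊗ₘ K) = ∫ x, (k2 x - 2 * g x * k x + g x ^ 2) ∂π := by
    rw [Measure.integral_compProd]
    · simp only [h2]
    · refine integrable_of_abs_le hmQ (b := (2 * b) ^ 2) fun z => ?_
      rw [abs_pow]
      exact pow_le_pow_left₀ (abs_nonneg _) ((abs_sub _ _).trans (by linarith [hb z.1, hb z.2])) 2
  have j1 : Integrable (fun x => g x ^ 2) π := integrable_of_abs_le hg2 hb2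
  have j2 : Integrable (fun x => 2 * g x * k x) π :=
    integrable_of_abs_le ((hg.const_mul 2).mul mk) (b := 2 * b * b) fun x => by
      have h3 := abs_nonneg (k x)
      rw [abs_mul, abs_mul, abs_two]
      have := abs_nonneg (g x)
      exact mul_le_mul (by linarith [hb x]) (bk x) h3 (by linarith [hb x])
  have j3 : Integrable (fun x => k x ^ 2) π :=
    integrable_of_abs_le (mk.pow_const 2) (b := b ^ 2) fun x => by
      rw [abs_pow]; exact pow_le_pow_left₀ (abs_nonneg _) (bk x) 2
  have j4 : Integrable k2 π := integrable_of_abs_le mk2 bk2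
  have j5 : Integrable (fun x => k2 x - 2 * g x * k x) π := j4.sub j2
  have j6 : Integrable (fun x => k2 x - 2 * g x * k x + g x ^ 2) π := j5.add j1
  have eD : ∫ x, (k2 x - 2 * g x * k x + g x ^ 2) ∂π =
      2 * ∫ x, g x ^ 2 ∂π - ∫ x, 2 * g x * k x ∂π := by
    rw [integral_add j5 j1, integral_sub j4 j2, ik2]; ring
  have j7 : Integrable (fun x => k x ^ 2 - 2 * g x * k x) π := j3.sub j2
  have j8 : Integrable (fun x => k x ^ 2 - 2 * g x * k x + g x ^ 2) π := j7.add j1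
  have hlaz : ∫ x, (k x ^ 2 - 2 * g x * k x + g x ^ 2) ∂π ≤
      ∫ x, 1 / 2 * (k2 x - 2 * g x * k x + g x ^ 2) ∂π := by
    refine integral_mono j8 (j6.const_mul _) fun x => ?_
    have := hlazy.sq_sub_le hg hb x
    rw [h1] at this
    have e : ∀ y, (g y - g x) ^ 2 = (g x - g y) ^ 2 := fun y => by ring
    simp only [e, h2] at this
    linarith
  rw [integral_add j7 j1, integral_sub j3 j2, integral_const_mul, eD] at hlaz
  have hch := hexp.cheeger (Measure.fst_compProd π K)
    ((Measure.snd_compProd π K).trans hK) hc hg hb hg0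
  rw [hD, eD] at hch
  linarith

/-- The deviation of the `m`-step transition probability to `A` from its limit. -/
noncomputable def deviation (K : Kernel X X) (π : Measure X) (A : Set X) (m : ℕ) (x : X) : ℝ :=
  ((K ^ m) x A).toReal - (π A).toReal

instance isMarkovKernel_pow (K : Kernel X X) [IsMarkovKernel K] (n : ℕ) :
    IsMarkovKernel (K ^ n) := by
  induction n with
  | zero => exact inferInstanceAs (IsMarkovKernel Kernel.id)
  | succ n ih =>
    rw [Kernel.pow_add, pow_one]
    infer_instance

variable {K : Kernel X X} {π : Measure X} {A : Set X}

theorem measurable_deviation (hA : MeasurableSet A) (m : ℕ) :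
    Measurable (deviation K π A m) :=
  ((Kernel.measurable_coe (K ^ m) hA).ennreal_toReal).sub_const _

theorem abs_deviation_le [IsMarkovKernel K] [IsProbabilityMeasure π] (m : ℕ) (x : X) :
    |deviation K π A m x| ≤ 1 := by
  have h1 : ((K ^ m) x A).toReal ≤ 1 := measureReal_le_one
  have h2 : (π A).toReal ≤ 1 := measureReal_le_one
  have h3 : 0 ≤ ((K ^ m) x A).toReal := ENNReal.toReal_nonneg
  have h4 : 0 ≤ (π A).toReal := ENNReal.toReal_nonneg
  rw [deviation, abs_le]
  constructor <;> linarith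

theorem integral_deviation_pow [IsMarkovKernel K] (hA : MeasurableSet A) (n m : ℕ) (x : X) :
    ∫ y, deviation K π A m y ∂(K ^ n) x = deviation K π A (n + m) x := by
  have i : Integrable (fun y => ((K ^ m) y A).toReal) ((K ^ n) x) :=
    integrable_of_abs_le (Kernel.measurable_coe (K ^ m) hA).ennreal_toReal (b := 1) fun y => by
      rw [abs_of_nonneg ENNReal.toReal_nonneg]; exact measureReal_le_one
  simp only [deviation]
  rw [integral_sub i (integrable_const _), integral_toReal
    (Kernel.measurable_coe (K ^ m) hA).aemeasurable (ae_of_all _ fun y => measure_lt_top _ _),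
    ← Kernel.pow_add_apply_eq_lintegral K n m x hA]
  simp

theorem deviation_zero (hA : MeasurableSet A) (x : X) :
    deviation K π A 0 x = A.indicator 1 x - (π A).toReal := by
  have : (K ^ 0) x = Measure.dirac x := by
    rw [pow_zero]; exact Kernel.id_apply x
  rw [deviation, this, Measure.dirac_apply' _ hA]
  by_cases hx : x ∈ A <;> simp [hx]

theorem integral_deviation [IsMarkovKernel K] [IsProbabilityMeasure π] (hK : K.Invariant π)
    (hA : MeasurableSet A) (m : ℕ) : ∫ x, deviation K π A m x ∂π = 0 := by
  induction m with
  | zero =>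
    simp only [deviation_zero hA]
    rw [integral_sub ((integrable_const 1).indicator hA) (integrable_const _),
      integral_indicator_one hA]
    simp [Measure.real]
  | succ m ih =>
    rw [← ih, ← integral_kernel_integral hK (measurable_deviation hA m) (abs_deviation_le m)]
    refine integral_congr_ae (ae_of_all _ fun x => ?_)
    have := integral_deviation_pow (K := K) (π := π) hA 1 m x
    rw [pow_one] at this
    simp only [this, add_comm]

theorem integral_deviation_sq_le [IsMarkovKernel K] [IsProbabilityMeasure π] (hK : K.Invariant π)
    (hlazy : IsLazy K) {c : ℝ} (hc : 0 < c) (hc1 : c ≤ 1) (hexp : HasExpansion (π ⊗ₘ K) π c)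
    (hA : MeasurableSet A) (m : ℕ) :
    ∫ x, deviation K π A m x ^ 2 ∂π ≤ (1 - c ^ 2 / 8) ^ m / 4 := by
  induction m with
  | zero =>
    -- At time 0 the squared norm is the variance `p(1 - p) ≤ 1/4` of an indicator.
    set p := (π A).toReal with hp
    have i1 : Integrable (A.indicator (1 : X → ℝ)) π := (integrable_const 1).indicator hA
    have e : ∀ x, deviation K π A 0 x ^ 2 = (1 - 2 * p) * A.indicator 1 x + p ^ 2 := by
      intro x
      rw [deviation_zero hA, ← hp]
      by_cases hx : x ∈ A <;> simp [hx] ; ring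
    simp only [e]
    rw [integral_add (i1.const_mul _) (integrable_const _), integral_const_mul,
      integral_indicator_one hA]
    simp only [Measure.real, ← hp, integral_const, measure_univ]
    simp
    nlinarith [sq_nonneg (2 * p - 1)]
  | succ m ih =>
    have h := contraction hK hlazy hc hexp (measurable_deviation (π := π) hA m)
      (abs_deviation_le m) (integral_deviation hK hA m)
    have e : ∀ x, ∫ y, deviation K π A m y ∂K x = deviation K π A (m + 1) x := fun x => by
      have := integral_deviation_pow (K := K) (π := π) hA 1 m x
      rw [pow_one] at this
      rw [this, add_comm]
    simp only [e] at h
    refine h.trans ?_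
    have h0 : 0 ≤ 1 - c ^ 2 / 8 := by nlinarith
    calc _ ≤ (1 - c ^ 2 / 8) * ((1 - c ^ 2 / 8) ^ m / 4) := mul_le_mul_of_nonneg_left ih h0
      _ = _ := by ring

/-- The deviation at time `n + m` is the average under `K^n(x, ·)` of the deviation at time `m`. On
the atom it is at most 1; on the part dominated by `C π` its L¹ norm is at most its L² norm, hence
at most `η`. -/
theorem tv_pow_add_le [IsMarkovKernel K] [IsProbabilityMeasure π] (hK : K.Invariant π)
    (hlazy : IsLazy K) {c : ℝ} (hc : 0 < c) (hc1 : c ≤ 1) (hexp : HasExpansion (π ⊗ₘ K) π c)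
    {n m : ℕ} {x : X} {s C η : ℝ}
    (hs : 0 ≤ s) (hC : 0 ≤ C) (hη : 0 ≤ η)
    (hle : (K ^ n) x ≤ ENNReal.ofReal s • Measure.dirac x + ENNReal.ofReal C • π)
    (hm : (1 - c ^ 2 / 8) ^ m / 4 ≤ η ^ 2) :
    tv ((K ^ (n + m)) x) π ≤ ENNReal.ofReal (s + C * η) := by
  refine iSup₂_le fun A hA => ?_
  have hd := measurable_deviation (K := K) (π := π) hA m
  have hi : ∀ μ : Measure X, ∀ _ : IsProbabilityMeasure μ,
      Integrable (fun y => |deviation K π A m y|) μ := fun μ _ =>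
    (integrable_of_abs_le hd (abs_deviation_le m)).abs
  have h1 : ∫ y, |deviation K π A m y| ∂π ≤ η := by
    refine abs_le_of_sq_le_sq' ?_ hη |>.2
    refine (sq_integral_le_integral_sq hd.abs (b := 1) fun y => ?_).trans ?_
    · rw [abs_abs]; exact abs_deviation_le m y
    · simp only [sq_abs]
      exact (integral_deviation_sq_le hK hlazy hc hc1 hexp hA m).trans hm
  have h2 : ∫⁻ y, ENNReal.ofReal |deviation K π A m y| ∂π ≤ ENNReal.ofReal η := by
    rw [← ofReal_integral_eq_lintegral_ofReal (hi π inferInstance)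
      (ae_of_all _ fun _ => abs_nonneg _)]
    exact ENNReal.ofReal_le_ofReal h1
  have h3 : (K ^ (n + m)) x A - π A = ENNReal.ofReal (deviation K π A (n + m) x) := by
    rw [deviation, ENNReal.ofReal_sub _ ENNReal.toReal_nonneg,
      ENNReal.ofReal_toReal (measure_ne_top _ _), ENNReal.ofReal_toReal (measure_ne_top _ _)]
  rw [h3, ← integral_deviation_pow hA n m x]
  calc ENNReal.ofReal (∫ y, deviation K π A m y ∂(K ^ n) x)
      ≤ ENNReal.ofReal (∫ y, |deviation K π A m y| ∂(K ^ n) x) :=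
        ENNReal.ofReal_le_ofReal (integral_mono (integrable_of_abs_le hd (abs_deviation_le m))
          (hi _ inferInstance) fun y => le_abs_self _)
    _ = ∫⁻ y, ENNReal.ofReal |deviation K π A m y| ∂(K ^ n) x :=
        ofReal_integral_eq_lintegral_ofReal (hi _ inferInstance) (ae_of_all _ fun _ => abs_nonneg _)
    _ ≤ ∫⁻ y, ENNReal.ofReal |deviation K π A m y|
          ∂(ENNReal.ofReal s • Measure.dirac x + ENNReal.ofReal C • π) :=
        lintegral_mono' hle le_rfl
    _ ≤ ENNReal.ofReal s * 1 + ENNReal.ofReal C * ENNReal.ofReal η := by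
        rw [lintegral_add_measure, lintegral_smul_measure, lintegral_smul_measure,
          lintegral_dirac' _ hd.abs.ennreal_ofReal]
        simp only [smul_eq_mul]
        gcongr
        rw [← ENNReal.ofReal_one]
        exact ENNReal.ofReal_le_ofReal (abs_deviation_le m x)
    _ = ENNReal.ofReal (s + C * η) := by
        rw [mul_one, ← ENNReal.ofReal_mul hC, ENNReal.ofReal_add hs (mul_nonneg hC hη)]

end Contraction

/-! ### Expansion of the base chain from fast mixing of a lift. -/

section Lift

variable {X Y : Type*} [MeasurableSpace X] [MeasurableSpace Y]

theorem invariant_pow {K : Kernel Y Y} {π : Measure Y} (hK : K.Invariant π) (n : ℕ) :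
    (K ^ n).Invariant π := by
  induction n with
  | zero => exact Measure.id_comp
  | succ n ih =>
    rw [Kernel.pow_add, pow_one]
    exact ih.comp hK

/-- The stationary probability of having left `S` at time `t` is at most `t` times the flow out
of `S`. -/
theorem setLIntegral_pow_compl_le {K : Kernel Y Y} [IsMarkovKernel K] {π : Measure Y}
    (hK : K.Invariant π) {S : Set Y} (hS : MeasurableSet S) (t : ℕ) :
    ∫⁻ y in S, (K ^ t) y Sᶜ ∂π ≤ t * ∫⁻ y in S, K y Sᶜ ∂π := by
  induction t with
  | zero =>
    have : ∀ y ∈ S, (K ^ 0) y Sᶜ = 0 := fun y hy => by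
      have : (K ^ 0) y = Measure.dirac y := by rw [pow_zero]; exact Kernel.id_apply y
      rw [this, Measure.dirac_apply' _ hS.compl]
      simp [hy]
    rw [setLIntegral_congr_fun hS this]
    simp
  | succ t ih =>
    set φ : Y → ℝ≥0∞ := S.indicator fun z => K z Sᶜ with hφ
    have mφ : Measurable φ := (K.measurable_coe hS.compl).indicator hS
    have hle : ∀ z, K z Sᶜ ≤ φ z + Sᶜ.indicator 1 z := by
      intro z
      by_cases hz : z ∈ S
      · simp [hφ, hz]
      · simp [hφ, hz, prob_le_one]
    -- Being outside `S` at time `t + 1` means being outside at time `t` or crossing in the last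
    -- step. By stationarity the crossing has probability at most the one-step flow.
    calc ∫⁻ y in S, (K ^ (t + 1)) y Sᶜ ∂π
        = ∫⁻ y in S, ∫⁻ z, K z Sᶜ ∂(K ^ t) y ∂π := by
          simp only [Kernel.pow_succ_apply_eq_lintegral K t _ hS.compl]
      _ ≤ ∫⁻ y in S, (∫⁻ z, φ z ∂(K ^ t) y + (K ^ t) y Sᶜ) ∂π := by
          refine lintegral_mono fun y => (lintegral_mono hle).trans ?_
          rw [lintegral_add_left mφ, lintegral_indicator_one hS.compl]
      _ = ∫⁻ y in S, ∫⁻ z, φ z ∂(K ^ t) y ∂π + ∫⁻ y in S, (K ^ t) y Sᶜ ∂π :=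
          lintegral_add_left mφ.lintegral_kernel _
      _ ≤ ∫⁻ y, ∫⁻ z, φ z ∂(K ^ t) y ∂π + t * ∫⁻ y in S, K y Sᶜ ∂π :=
          add_le_add (setLIntegral_le_lintegral _ _) ih
      _ = ((t + 1 : ℕ) : ℝ≥0∞) * ∫⁻ y in S, K y Sᶜ ∂π := by
          rw [← Measure.lintegral_bind (K ^ t).aemeasurable mφ.aemeasurable,
            (invariant_pow hK t).def, hφ, lintegral_indicator hS]
          push_cast
          ring

theorem cond_bind_apply {K : Kernel X X} {π : Measure X} {S A : Set X}
    (hA : MeasurableSet A) : ((cond π S).bind K) A = (π S)⁻¹ * ∫⁻ x in S, K x A ∂π := by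
  rw [Measure.bind_apply hA K.aemeasurable, ProbabilityTheory.cond, lintegral_smul_measure, smul_eq_mul]

theorem measure_le_flow_of_isLift {K : Kernel X X} [IsMarkovKernel K] {π : Measure X}
    [IsProbabilityMeasure π] (hK : K.Invariant π) {K' : Kernel Y Y} [IsMarkovKernel K']
    {π' : Measure Y} [IsProbabilityMeasure π'] (hK' : K'.Invariant π') (hl : IsLift K' π' K π)
    {T : ℕ} (hT : (⨆ y, tv ((K' ^ T) y) π') < 1 / 4) {S : Set X} (hS : MeasurableSet S)
    (hS2 : π S ≤ 1 / 2) : π S ≤ 4 * T * ∫⁻ x in S, K x Sᶜ ∂π := by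
  obtain ⟨f, hf, hl⟩ := hl
  have hmap : ∀ A, MeasurableSet A → π' (f ⁻¹' A) = π A := by
    intro A hA
    -- Taking `S` to be the whole space, invariance on both sides shows that `f` maps `π'` to `π`.
    have h := hl Set.univ .univ (by simp)
    rw [Set.preimage_univ, cond_univ, cond_univ, hK.def, hK'.def] at h
    rw [← h, Measure.map_apply hf hA]
  rcases eq_or_ne (π S) 0 with h0 | h0
  · simp [h0]
  have hS' : MeasurableSet (f ⁻¹' S) := hf hS
  have hflow : ∫⁻ y in f ⁻¹' S, K' y (f ⁻¹' S)ᶜ ∂π' = ∫⁻ x in S, K x Sᶜ ∂π := by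
    have h := congrArg (fun μ : Measure X => μ Sᶜ) (hl S hS (pos_iff_ne_zero.2 h0))
    rw [Measure.map_apply hf hS.compl, cond_bind_apply hS.compl, cond_bind_apply (hf hS.compl),
      hmap S hS, ENNReal.mul_right_inj (by simp) (by simp [h0])] at h
    exact h
  -- Here 1/4 is `1 - (1/4 + 1/2)`: the mixing error and the bound on `π S`.
  have hout : ∀ y, 1 / 4 ≤ (K' ^ T) y (f ⁻¹' S)ᶜ := by
    intro y
    have h1 : (K' ^ T) y (f ⁻¹' S) - π' (f ⁻¹' S) ≤ 1 / 4 :=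
      ((le_iSup₂_of_le (f := fun (A : Set Y) (_ : MeasurableSet A) => (K' ^ T) y A - π' A)
        _ hS' le_rfl).trans (le_iSup (fun y => tv ((K' ^ T) y) π') y)).trans hT.le
    rw [hmap S hS, tsub_le_iff_right] at h1
    rw [prob_compl_eq_one_sub hS']
    have h2 : (K' ^ T) y (f ⁻¹' S) ≤ 1 / 4 + 1 / 2 := h1.trans (by gcongr)
    refine le_trans ?_ (tsub_le_tsub_left h2 1)
    refine ENNReal.le_sub_of_add_le_right (by finiteness) ?_
    rw [← ENNReal.toReal_le_toReal (by finiteness) (by finiteness)]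
    rw [ENNReal.toReal_add (by finiteness) (by finiteness),
      ENNReal.toReal_add (by finiteness) (by finiteness)]
    norm_num
  have h3 := setLIntegral_pow_compl_le hK' hS' T
  rw [hflow] at h3
  have h4 : 1 / 4 * π S ≤ T * ∫⁻ x in S, K x Sᶜ ∂π := by
    refine le_trans ?_ h3
    rw [← hmap S hS, ← setLIntegral_const]
    exact lintegral_mono fun y => hout y
  calc π S = 4 * (1 / 4 * π S) := by
        rw [← mul_assoc, one_div, ENNReal.mul_inv_cancel (by simp) (by simp), one_mul]
    _ ≤ 4 * (T * ∫⁻ x in S, K x Sᶜ ∂π) := by gcongr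
    _ = _ := by rw [mul_assoc]

end Lift

/-! ### Atoms and densities of the powers of `K`. -/

namespace LazyRep

variable {X : Type*} [MeasurableSpace X] {K : Kernel X X} {π : Measure X}

/-- The law of the position after a move from `x`. -/
noncomputable def jump (R : LazyRep K π) (x : X) : Measure X :=
  Measure.sum fun U : R.𝒰 x => R.w x U • cond π (U : Set X)

theorem eq_jump (R : LazyRep K π) (x : X) : K x = ENNReal.ofReal (R.α x) • Measure.dirac x +
    ENNReal.ofReal (1 - R.α x) • R.jump x := R.kernel_eq x

theorem apply_eq (R : LazyRep K π) (x : X) (A : Set X) :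
    K x A = ENNReal.ofReal (R.α x) * Measure.dirac x A +
      ENNReal.ofReal (1 - R.α x) * R.jump x A := by
  rw [R.eq_jump]; rfl

theorem isProbabilityMeasure_jump [IsMarkovKernel K] (R : LazyRep K π) (x : X) :
    IsProbabilityMeasure (R.jump x) := by
  have h := R.apply_eq x Set.univ
  have ha := R.α_lt_one x
  have ha0 := R.half_le_α x
  have e : (1 : ℝ≥0∞) = ENNReal.ofReal (R.α x) + ENNReal.ofReal (1 - R.α x) := by
    rw [← ENNReal.ofReal_add (by linarith) (by linarith)]; simp
  rw [measure_univ, measure_univ, mul_one] at h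
  nth_rewrite 1 [e] at h
  rw [ENNReal.add_right_inj ENNReal.ofReal_ne_top] at h
  constructor
  have h0 : ENNReal.ofReal (1 - R.α x) ≠ 0 := by
    simp only [ne_eq, ENNReal.ofReal_eq_zero, not_le]; linarith
  rw [← ENNReal.mul_right_inj h0 ENNReal.ofReal_ne_top, ← h, mul_one]

theorem isLazy [IsMarkovKernel K] (R : LazyRep K π) : IsLazy K := fun x =>
  ⟨R.α x, R.jump x, R.isProbabilityMeasure_jump x, R.half_le_α x, (R.α_lt_one x).le, R.eq_jump x⟩

theorem jump_le (R : LazyRep K π) (x : X) {A : Set X} (hA : MeasurableSet A) :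
    R.jump x A ≤ R.piStar⁻¹ * π A := by
  rw [jump, Measure.sum_apply _ hA]
  calc ∑' U : R.𝒰 x, (R.w x U • cond π (U : Set X)) A
      ≤ ∑' U : R.𝒰 x, R.w x U * (R.piStar⁻¹ * π A) := by
        refine ENNReal.tsum_le_tsum fun U => ?_
        rw [Measure.smul_apply, smul_eq_mul, cond_apply (R.measurableSet_𝒰 x U U.2)]
        rcases eq_or_ne (R.w x U) 0 with h0 | h0
        · simp [h0]
        · have : R.piStar ≤ π U := sInf_le ⟨x, U, U.2, pos_iff_ne_zero.2 h0, rfl⟩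
          gcongr
          exact Set.inter_subset_right
    _ = R.piStar⁻¹ * π A := by rw [ENNReal.tsum_mul_right, R.sum_w, one_mul]

theorem piStar_le_one [IsProbabilityMeasure π] [hne : Nonempty X] (R : LazyRep K π) :
    R.piStar ≤ 1 := by
  obtain ⟨x⟩ := hne
  obtain ⟨U, hU⟩ : ∃ U : R.𝒰 x, R.w x U ≠ 0 := by
    by_contra! h
    have := R.sum_w x
    simp [h] at this
  have : R.piStar ≤ π U := sInf_le ⟨x, U, U.2, pos_iff_ne_zero.2 hU, rfl⟩
  exact this.trans prob_le_one

/-- Under one more step the part dominated by `π` stays so by invariance, while the atom keeps the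
fraction `α_x` and releases the rest with density at most `C = 1/π_*`. -/
theorem pow_le [IsMarkovKernel K] [IsProbabilityMeasure π] (R : LazyRep K π)
    (hK : K.Invariant π) {C : ℝ} (hC : R.piStar⁻¹ = ENNReal.ofReal C) (hC0 : 0 ≤ C) (x : X)
    (n : ℕ) : (K ^ n) x ≤ ENNReal.ofReal (R.α x ^ n) • Measure.dirac x +
      ENNReal.ofReal ((1 - R.α x ^ n) * C) • π := by
  have ha := R.α_lt_one x
  have ha0 : 0 ≤ R.α x := by linarith [R.half_le_α x]
  induction n with
  | zero =>
    have : (K ^ 0) x = Measure.dirac x := by rw [pow_zero]; exact Kernel.id_apply x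
    rw [this]
    simp
  | succ n ih =>
    have hp : R.α x ^ n ≤ 1 := pow_le_one₀ ha0 ha.le
    refine Measure.le_iff.2 fun A hA => ?_
    have hm := K.measurable_coe hA
    rw [Kernel.pow_succ_apply_eq_lintegral K n x hA]
    refine (lintegral_mono' ih le_rfl).trans ?_
    have hinv : ∫⁻ y, K y A ∂π = π A := by
      rw [← Measure.bind_apply hA K.aemeasurable, hK.def]
    rw [lintegral_add_measure, lintegral_smul_measure, lintegral_smul_measure,
      lintegral_dirac' _ hm, hinv, R.apply_eq]
    simp only [Measure.add_apply, Measure.smul_apply, smul_eq_mul]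
    calc _ ≤ ENNReal.ofReal (R.α x ^ n) * (ENNReal.ofReal (R.α x) * Measure.dirac x A +
          ENNReal.ofReal (1 - R.α x) * (ENNReal.ofReal C * π A)) +
          ENNReal.ofReal ((1 - R.α x ^ n) * C) * π A := by
          gcongr
          rw [← hC]
          exact R.jump_le x hA
      _ = ENNReal.ofReal (R.α x ^ n * R.α x) * Measure.dirac x A +
          ENNReal.ofReal (R.α x ^ n * ((1 - R.α x) * C) + (1 - R.α x ^ n) * C) * π A := by
          rw [ENNReal.ofReal_add (mul_nonneg (by positivity) (mul_nonneg (by linarith) hC0))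
            (mul_nonneg (by linarith) hC0), ENNReal.ofReal_mul (p := R.α x ^ n) (by positivity),
            ENNReal.ofReal_mul (p := R.α x ^ n) (by positivity),
            ENNReal.ofReal_mul (p := 1 - R.α x) (by linarith)]
          ring
      _ = _ := by
          congr 3
          ring_nf

/-- Testing total variation on `{x}`, which a nearby `y ≠ x` cannot reach because `π` has no atoms,
shows that `α` cannot drop abruptly near `x`. If `α_x > 1 - c`, a small ball at `x` would thus have
outflow less than `c` times its measure. -/
theorem α_le [IsMarkovKernel K] [MetricSpace X] [BorelSpace X] [IsProbabilityMeasure π]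
    (R : LazyRep K π) (hatom : ∀ x, π {x} = 0)
    (hball : ∀ x r, 0 < r → 0 < π (Metric.ball x r))
    (htv : ∀ ε : ℝ, 0 < ε → ∃ δ : ℝ, 0 < δ ∧ ∀ x y : X, dist x y ≤ δ →
      tv (K x) (K y) ≤ ENNReal.ofReal (min (R.α x) (R.α y) + ε))
    {c : ℝ} (hexp : HasExpansion (π ⊗ₘ K) π c) (x : X) : R.α x ≤ 1 - c := by
  by_contra! hx
  -- Half of the excess, so that `1 - α_x + ε` is still below `c`.
  set ε := (R.α x - (1 - c)) / 2 with hε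
  have hε0 : 0 < ε := by rw [hε]; linarith
  obtain ⟨δ, hδ, htv⟩ := htv ε hε0
  obtain ⟨U, hxU, hUo, hU⟩ := Set.exists_isOpen_lt_of_lt {x} (1 / 2 : ℝ≥0∞)
    (μ := π) (by rw [hatom]; norm_num)
  obtain ⟨r, hr, hrU⟩ := Metric.isOpen_iff.1 hUo x (hxU rfl)
  set B := Metric.ball x (min r δ) with hB
  have hBm : MeasurableSet B := measurableSet_ball
  have hB2 : π B ≤ 1 / 2 :=
    (measure_mono ((Metric.ball_subset_ball (min_le_left _ _)).trans hrU)).trans hU.le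
  have hB0 : 0 < π B := hball x _ (lt_min hr hδ)
  have hα : ∀ y ∈ B, R.α x - ε ≤ R.α y := by
    intro y hy
    rcases eq_or_ne y x with rfl | hne
    · linarith
    have hd : dist x y ≤ δ := by
      rw [dist_comm]
      exact (Metric.mem_ball.1 hy).le.trans (min_le_right _ _)
    have h1 : K x {x} - K y {x} ≤ tv (K x) (K y) :=
      le_iSup₂_of_le (f := fun (A : Set X) (_ : MeasurableSet A) => K x A - K y A)
        {x} (measurableSet_singleton x) le_rfl
    have h2 : K y {x} = 0 := by
      have := R.jump_le y (measurableSet_singleton x)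
      rw [hatom, mul_zero, nonpos_iff_eq_zero] at this
      rw [R.apply_eq, this, Measure.dirac_apply' _ (measurableSet_singleton x)]
      simp [hne]
    have h3 : ENNReal.ofReal (R.α x) ≤ K x {x} := by
      rw [R.apply_eq, Measure.dirac_apply' _ (measurableSet_singleton x)]
      simp
    rw [h2, tsub_zero] at h1
    have h4 := h3.trans (h1.trans (htv x y hd))
    rw [ENNReal.ofReal_le_ofReal_iff
      (by linarith [le_min (R.half_le_α x) (R.half_le_α y)])] at h4
    linarith [min_le_right (R.α x) (R.α y)]
  have hflow : (π ⊗ₘ K) (B ×ˢ Bᶜ) ≤ ENNReal.ofReal (1 - R.α x + ε) * π B := by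
    rw [Measure.compProd_apply_prod hBm hBm.compl, ← setLIntegral_const]
    refine setLIntegral_mono' hBm fun y hy => ?_
    have := R.isProbabilityMeasure_jump y
    rw [R.apply_eq, Measure.dirac_apply' _ hBm.compl, Set.indicator_of_notMem (by simpa using hy),
      mul_zero, zero_add]
    calc _ ≤ ENNReal.ofReal (1 - R.α y) * 1 := by gcongr; exact prob_le_one
      _ ≤ _ := by
        rw [mul_one]
        exact ENNReal.ofReal_le_ofReal (by linarith [hα y hy])
  have h5 := (hexp B hBm hB2).trans hflow
  rw [ENNReal.mul_le_mul_iff_left hB0.ne' (measure_ne_top _ _),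
    ENNReal.ofReal_le_ofReal_iff (by linarith [R.α_lt_one x])] at h5
  linarith

end LazyRep

/-! ### Mixing time bounds and the numerical constant. -/

theorem mixingTime_le {X : Type*} [MeasurableSpace X] {K : Kernel X X} {π : Measure X} {N : ℕ}
    {η : ℝ} (hη : η < 1 / 4) (h : ∀ x, tv ((K ^ N) x) π ≤ ENNReal.ofReal η) :
    mixingTime K π ≤ N := by
  refine iInf₂_le_of_le N ((iSup_le h).trans_lt ?_) le_rfl
  have : (1 / 4 : ℝ≥0∞) = ENNReal.ofReal (1 / 4) := by
    rw [ENNReal.ofReal_div_of_pos (by norm_num)]; simp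
  rw [this]
  exact (ENNReal.ofReal_lt_ofReal_iff (by norm_num)).2 hη

theorem mixingTime_eq_zero_of_subsingleton {X : Type*} [MeasurableSpace X] [Subsingleton X]
    (K : Kernel X X) (π : Measure X) [IsProbabilityMeasure π] : mixingTime K π = 0 := by
  have h : mixingTime K π ≤ (0 : ℕ) := by
    refine mixingTime_le (η := 0) (by norm_num) fun x => ?_
    refine iSup₂_le fun A hA => ?_
    have : (K ^ 0) x = Measure.dirac x := by rw [pow_zero]; exact Kernel.id_apply x
    rw [this, Measure.dirac_apply' _ hA]
    rcases Set.eq_empty_or_nonempty A with rfl | ⟨y, hy⟩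
    · simp
    · have hu : A = Set.univ := by
        ext z; simpa [Subsingleton.elim z y] using hy
      simp [hu]
  simpa using h

theorem liftConst_mul_sqrt_le {p β γ : ℝ} (hp : 0 < p) (hp1 : p ≤ 1) (hβ : 0 < β) (hβ1 : β ≤ 1)
    (hγ1 : γ ≤ 1) {T N : ℝ} (hT : 1 ≤ T)
    (hN : N ≤ 16 * T + 256 * T ^ 2 * Real.log (4 / p) + 1) :
    liftConst p β γ * √N ≤ T := by
  have hlog2 := Real.log_two_gt_d9
  have h1 : 2 * Real.log 2 ≤ Real.log (4 / p) := by
    have : 2 * Real.log 2 = Real.log 4 := by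
      rw [← Real.log_rpow (by norm_num)]; norm_num
    rw [this]
    refine Real.log_le_log (by norm_num) ?_
    rw [le_div_iff₀ hp]; linarith
  have h2 : Real.log 2 ≤ Real.log (2 / √β) := by
    refine Real.log_le_log (by norm_num) ?_
    rw [le_div_iff₀ (Real.sqrt_pos.2 hβ)]
    linarith [Real.sqrt_le_one.2 hβ1]
  set L := Real.log (4 / p) with hL
  set M := Real.log (2 / √β) with hM
  have hpos : 0 < 2 * L * M := by
    have : 0 < L := by linarith
    have : 0 < M := by linarith
    positivity
  have hγ : √γ ≤ 1 := Real.sqrt_le_one.2 hγ1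
  rw [liftConst, ← hL, ← hM, div_mul_eq_mul_div, div_le_iff₀ (by positivity)]
  -- The right side is `512 T² L M`. As `M ≥ log 2 > 1/2`, it exceeds `256 T² L` by enough to absorb
  -- `16 T + 1`, using `T ≥ 1` and `L ≥ 2 log 2`.
  have hN2 : N ≤ (16 * T) ^ 2 * (2 * L * M) := by
    have h3 : T ≤ T ^ 2 := by nlinarith
    have h4 : 0 ≤ T ^ 2 * (L - 1.38) := mul_nonneg (by positivity) (by linarith)
    have h5 : 0 ≤ T ^ 2 * L * (M - 0.69) := mul_nonneg (mul_nonneg (by positivity) (by linarith))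
      (by linarith)
    nlinarith
  calc √γ * √N ≤ 1 * √N := by gcongr
    _ ≤ √((16 * T) ^ 2 * (2 * L * M)) := by rw [one_mul]; exact Real.sqrt_le_sqrt hN2
    _ = T * (16 * √(2 * L * M)) := by
        rw [Real.sqrt_mul (by positivity), Real.sqrt_sq (by positivity)]; ring

section Metric

variable {X : Type*} [MetricSpace X] [MeasurableSpace X] [BorelSpace X] {K : Kernel X X}
  [IsMarkovKernel K] {π : Measure X} [IsProbabilityMeasure π]

theorem mixingTime_le_of_hasExpansion (R : LazyRep K π) (hK : K.Invariant π)
    (hp : 0 < R.piStar) (hatom : ∀ x, π {x} = 0)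
    (hball : ∀ x r, 0 < r → 0 < π (Metric.ball x r))
    (htv : ∀ ε : ℝ, 0 < ε → ∃ δ : ℝ, 0 < δ ∧ ∀ x y : X, dist x y ≤ δ →
      tv (K x) (K y) ≤ ENNReal.ofReal (min (R.α x) (R.α y) + ε))
    {T : ℕ} (hT : 1 ≤ T) (hexp : HasExpansion (π ⊗ₘ K) π (1 / (4 * T))) :
    mixingTime K π ≤
      ((16 * T + ⌈256 * (T : ℝ) ^ 2 * Real.log (4 / R.piStar.toReal)⌉₊ : ℕ) : ℝ≥0∞) := by
  have hT' : (1 : ℝ) ≤ T := by exact_mod_cast hT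
  have hT0 : (0 : ℝ) < T := by linarith
  rcases isEmpty_or_nonempty X with hX | hX
  · rw [mixingTime_eq_zero_of_subsingleton]; exact zero_le
  have hp1 := R.piStar_le_one
  have hptop : R.piStar ≠ ∞ := ne_top_of_le_ne_top ENNReal.one_ne_top hp1
  set p := R.piStar.toReal with hpdef
  have hp0 : 0 < p := ENNReal.toReal_pos hp.ne' hptop
  have hpinv : R.piStar⁻¹ = ENNReal.ofReal p⁻¹ := by
    rw [ENNReal.ofReal_inv_of_pos hp0, hpdef, ENNReal.ofReal_toReal hptop]
  set m := ⌈256 * (T : ℝ) ^ 2 * Real.log (4 / p)⌉₊ with hm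
  set c : ℝ := 1 / (4 * T) with hc
  have hc0 : 0 < c := by positivity
  have hc1 : c ≤ 1 := by rw [hc, div_le_one (by positivity)]; linarith
  have hexp4 : Real.exp (-4) ≤ 1 / 16 := by
    have h : (2 : ℝ) ≤ Real.exp 1 := by linarith [Real.add_one_le_exp (1 : ℝ)]
    have h4 : (16 : ℝ) ≤ Real.exp 4 := by
      have : Real.exp 4 = Real.exp 1 ^ 4 := by rw [← Real.exp_nat_mul]; norm_num
      rw [this]
      calc (16 : ℝ) = 2 ^ 4 := by norm_num
        _ ≤ _ := by gcongr
    rw [Real.exp_neg, one_div]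
    exact inv_anti₀ (by norm_num) h4
  -- The atom contributes 1/16, and density `1/p` times L² norm `p/8` contributes 1/8: 3/16 in
  -- total.
  refine mixingTime_le (η := 1 / 16 + p⁻¹ * (p / 8)) ?_ fun x => ?_
  · rw [show p⁻¹ * (p / 8) = 1 / 8 by field_simp]; norm_num
  have hα0 : 0 ≤ R.α x := by linarith [R.half_le_α x]
  have hα : R.α x ≤ 1 - c := R.α_le hatom hball htv hexp x
  have hαn : R.α x ^ (16 * T) ≤ 1 / 16 := by
    calc R.α x ^ (16 * T) ≤ Real.exp (-c) ^ (16 * T) := by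
          gcongr
          linarith [Real.add_one_le_exp (-c)]
      _ = Real.exp (-4) := by
          rw [← Real.exp_nat_mul]
          congr 1
          rw [hc]
          push_cast
          field_simp
          norm_num
      _ ≤ 1 / 16 := hexp4
  refine tv_pow_add_le hK R.isLazy hc0 hc1 hexp (by norm_num) (by positivity) (by positivity)
    ((R.pow_le hK hpinv (by positivity) x (16 * T)).trans ?_) ?_
  · gcongr
    refine mul_le_of_le_one_left (by positivity) ?_
    linarith [pow_nonneg hα0 (16 * T)]
  · have h1 : 256 * (T : ℝ) ^ 2 * Real.log (4 / p) ≤ m := Nat.le_ceil _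
    have h2 : (1 - c ^ 2 / 8) ^ m ≤ (p / 4) ^ 2 := by
      calc (1 - c ^ 2 / 8) ^ m ≤ Real.exp (-(c ^ 2 / 8)) ^ m := by
            refine pow_le_pow_left₀ (by nlinarith) ?_ m
            linarith [Real.add_one_le_exp (-(c ^ 2 / 8))]
        _ = Real.exp (-(m / (128 * T ^ 2))) := by
            rw [← Real.exp_nat_mul]
            congr 1
            rw [hc]
            field_simp
            ring
        _ ≤ Real.exp (-(2 * Real.log (4 / p))) := by
            refine Real.exp_le_exp.2 (neg_le_neg ?_)
            rw [le_div_iff₀ (by positivity)]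
            linarith
        _ = (p / 4) ^ 2 := by
            have : -(2 * Real.log (4 / p)) = (2 : ℕ) * Real.log (p / 4) := by
              rw [← inv_div, Real.log_inv]; push_cast; ring
            rw [this, Real.exp_nat_mul, Real.exp_log (by positivity)]
    calc _ ≤ (p / 4) ^ 2 / 4 := by gcongr
      _ = _ := by ring

theorem liftConst_mul_mixingTime_le (R : LazyRep K π) (hK : K.Invariant π)
    (hp : 0 < R.piStar) (hatom : ∀ x, π {x} = 0)
    (hball : ∀ x r, 0 < r → 0 < π (Metric.ball x r))
    (htv : ∀ ε : ℝ, 0 < ε → ∃ δ : ℝ, 0 < δ ∧ ∀ x y : X, dist x y ≤ δ →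
      tv (K x) (K y) ≤ ENNReal.ofReal (min (R.α x) (R.α y) + ε))
    {β γ : ℝ} (hβ : 0 < β) (hβ1 : β ≤ 1) (hγ1 : γ ≤ 1)
    {Y : Type*} [MeasurableSpace Y] {K' : Kernel Y Y} [IsMarkovKernel K'] {π' : Measure Y}
    [IsProbabilityMeasure π'] (hK' : K'.Invariant π') (hl : IsLift K' π' K π) :
    ENNReal.ofReal (liftConst R.piStar.toReal β γ) * mixingTime K π ^ (1 / 2 : ℝ) ≤
      mixingTime K' π' := by
  obtain ⟨x₀⟩ : Nonempty X := by
    by_contra h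
    rw [not_nonempty_iff] at h
    have := measure_univ (μ := π)
    simp [Measure.eq_zero_of_isEmpty π] at this
  refine le_iInf₂ fun T hT => ?_
  have hflow := fun S hS hS2 => measure_le_flow_of_isLift hK hK' hl hT (S := S) hS hS2
  -- With `T = 0` the flow bound would make every open set of measure at most 1/2 null, but a small
  -- enough one around `x₀` has positive measure.
  have hT1 : 1 ≤ T := by
    by_contra! h0
    obtain ⟨U, hxU, hUo, hU⟩ := Set.exists_isOpen_lt_of_lt {x₀} (1 / 2 : ℝ≥0∞)
      (μ := π) (by rw [hatom]; norm_num)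
    obtain ⟨r, hr, hrU⟩ := Metric.isOpen_iff.1 hUo x₀ (hxU rfl)
    have h1 := hflow U hUo.measurableSet hU.le
    rw [Nat.lt_one_iff.1 h0] at h1
    have h2 := (hball x₀ r hr).trans_le (measure_mono hrU)
    simp at h1
    exact h2.ne' h1
  have hT' : (1 : ℝ) ≤ T := by exact_mod_cast hT1
  have hexp : HasExpansion (π ⊗ₘ K) π (1 / (4 * T)) := by
    intro S hS hS2
    rw [Measure.compProd_apply_prod hS hS.compl]
    have h4 : ENNReal.ofReal (1 / (4 * T)) = (4 * (T : ℝ≥0∞))⁻¹ := by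
      rw [one_div, ENNReal.ofReal_inv_of_pos (by positivity), ENNReal.ofReal_mul (by norm_num)]
      simp
    rw [h4, ENNReal.inv_mul_le_iff (by simp; omega) (by finiteness)]
    exact hflow S hS hS2
  have hmix := mixingTime_le_of_hasExpansion R hK hp hatom hball htv hT1 hexp
  have hX : Nonempty X := ⟨x₀⟩
  have hp1 := R.piStar_le_one
  have hptop : R.piStar ≠ ∞ := ne_top_of_le_ne_top ENNReal.one_ne_top hp1
  have hp0 : 0 < R.piStar.toReal := ENNReal.toReal_pos hp.ne' hptop
  have hp1' : R.piStar.toReal ≤ 1 := ENNReal.toReal_le_of_le_ofReal zero_le_one (by simpa using hp1)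
  set N := 16 * T + ⌈256 * (T : ℝ) ^ 2 * Real.log (4 / R.piStar.toReal)⌉₊ with hN
  have hlog : 0 ≤ Real.log (4 / R.piStar.toReal) :=
    Real.log_nonneg (by rw [le_div_iff₀ hp0]; linarith)
  have hN' : (N : ℝ) ≤ 16 * T + 256 * T ^ 2 * Real.log (4 / R.piStar.toReal) + 1 := by
    have := Nat.ceil_lt_add_one (a := 256 * (T : ℝ) ^ 2 * Real.log (4 / R.piStar.toReal))
      (by positivity)
    rw [hN]
    push_cast
    linarith
  have hfin := liftConst_mul_sqrt_le hp0 hp1' hβ hβ1 hγ1 hT' hN'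
  calc _ ≤ ENNReal.ofReal (liftConst R.piStar.toReal β γ) * (N : ℝ≥0∞) ^ (1 / 2 : ℝ) := by gcongr
    _ = ENNReal.ofReal (liftConst R.piStar.toReal β γ * √N) := by
        have hc0 : 0 ≤ liftConst R.piStar.toReal β γ := by rw [liftConst]; positivity
        rw [ENNReal.ofReal_mul hc0, Real.sqrt_eq_rpow,
          ← ENNReal.ofReal_rpow_of_nonneg (Nat.cast_nonneg N) (by norm_num), ENNReal.ofReal_natCast]
    _ ≤ ENNReal.ofReal T := ENNReal.ofReal_le_ofReal hfin
    _ = T := ENNReal.ofReal_natCast T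

end Metric

/-! ### Euclidean space and the torus: `π` has no atoms and charges balls. -/

theorem Assumptions.liftConst_mul_mixingTime_le {d : ℕ} {E : Type*} [MetricSpace E]
    [MeasureSpace E] [BorelSpace E] [NullSingletonClass (volume : Measure E)]
    {p : (Fin d → ℝ) → E} {Ω : Set E} (hΩ : IsCompact Ω)
    (hball : ∀ x ∈ Ω, ∀ r : ℝ, 0 < r → 0 < volume (Ω ∩ Metric.ball x r))
    {π : Measure Ω} [IsProbabilityMeasure π] {K : Kernel Ω Ω} [IsMarkovKernel K]
    {R : LazyRep K π} {β γ : ℝ} (h : Assumptions p Ω π K R β γ)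
    {Y : Type*} [MeasurableSpace Y] {K' : Kernel Y Y} [IsMarkovKernel K'] {π' : Measure Y}
    [IsProbabilityMeasure π'] (hK' : K'.Invariant π') (hl : IsLift K' π' K π) :
    ENNReal.ofReal (liftConst R.piStar.toReal β γ) * mixingTime K π ^ (1 / 2 : ℝ) ≤
      mixingTime K' π' := by
  obtain ⟨ρ, hρ, ⟨C, hC, hρC⟩, -⟩ := h.density
  have hΩm : MeasurableSet Ω := hΩ.isClosed.measurableSet
  refine LiftBound.liftConst_mul_mixingTime_le R h.reversible.invariant h.piStar_pos ?_ ?_ h.tv_cont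
    h.β_pos h.β_le_one h.γ_le_one hK' hl
  · intro x
    have h1 : π.map Subtype.val {x.1} = 0 := by
      rw [hρ]
      exact withDensity_absolutelyContinuous _ _
        (Measure.absolutelyContinuous_of_le Measure.restrict_le_self (measure_singleton x.1))
    rw [Measure.map_apply measurable_subtype_coe (measurableSet_singleton _)] at h1
    refine measure_mono_null ?_ h1
    simp
  · intro x r hr
    have h1 : π (Metric.ball x r) = π.map Subtype.val (Metric.ball x.1 r) := by
      rw [Measure.map_apply measurable_subtype_coe measurableSet_ball]
      rfl
    rw [h1, hρ, withDensity_apply _ measurableSet_ball, Measure.restrict_restrict measurableSet_ball]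
    have hpos : 0 < ENNReal.ofReal C⁻¹ * volume (Metric.ball x.1 r ∩ Ω) := by
      rw [Set.inter_comm]
      exact ENNReal.mul_pos (by simpa using hC) (hball x.1 x.2 r hr).ne'
    refine hpos.trans_le ?_
    rw [← setLIntegral_const]
    exact setLIntegral_mono' (measurableSet_ball.inter hΩm) fun y hy =>
      ENNReal.ofReal_le_ofReal (hρC y hy.2).1.le

theorem nullSingletonClass_unitAddCircle :
    NullSingletonClass (volume : Measure UnitAddCircle) where
  measure_singleton x := by
    have := AddCircle.volume_closedBall (1 : ℝ) (x := x) 0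
    simpa using this

end LiftBound

theorem theorem1 (d : ℕ) :
    -- compact subsets of Euclidean space, with the sup metric and Lebesgue measure
    (∀ (Ω : Set (Fin d → ℝ)), IsCompact Ω →
      (∀ x ∈ Ω, ∀ r : ℝ, 0 < r → 0 < volume (Ω ∩ Metric.ball x r)) →
      ∀ (π : Measure Ω) [IsProbabilityMeasure π] (K : Kernel Ω Ω) [IsMarkovKernel K]
        (R : LiftBound.LazyRep K π) (β γ : ℝ),
        LiftBound.Assumptions id Ω π K R β γ →
        ∀ (Ω' : Type*) [MeasurableSpace Ω'] (π' : Measure Ω') [IsProbabilityMeasure π']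
          (K' : Kernel Ω' Ω') [IsMarkovKernel K'],
          K'.Invariant π' → LiftBound.IsLift K' π' K π →
          ENNReal.ofReal (LiftBound.liftConst R.piStar.toReal β γ) *
              LiftBound.mixingTime K π ^ (1 / 2 : ℝ) ≤ LiftBound.mixingTime K' π') ∧
    -- compact subsets of the torus, with the sup metric and Lebesgue measure
    (∀ (Ω : Set (Fin d → UnitAddCircle)), IsCompact Ω →
      (∀ x ∈ Ω, ∀ r : ℝ, 0 < r → 0 < volume (Ω ∩ Metric.ball x r)) →
      ∀ (π : Measure Ω) [IsProbabilityMeasure π] (K : Kernel Ω Ω) [IsMarkovKernel K]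
        (R : LiftBound.LazyRep K π) (β γ : ℝ),
        LiftBound.Assumptions (fun y i => (y i : UnitAddCircle)) Ω π K R β γ →
        ∀ (Ω' : Type*) [MeasurableSpace Ω'] (π' : Measure Ω') [IsProbabilityMeasure π']
          (K' : Kernel Ω' Ω') [IsMarkovKernel K'],
          K'.Invariant π' → LiftBound.IsLift K' π' K π →
          ENNReal.ofReal (LiftBound.liftConst R.piStar.toReal β γ) *
              LiftBound.mixingTime K π ^ (1 / 2 : ℝ) ≤ LiftBound.mixingTime K' π') := by
  refine ⟨fun Ω hΩ hball π _ K _ R β γ h Ω' _ π' _ K' _ hK' hl => ?_,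
    fun Ω hΩ hball π _ K _ R β γ h Ω' _ π' _ K' _ hK' hl => ?_⟩
  · rcases Nat.eq_zero_or_pos d with rfl | hd
    -- In dimension 0 points have positive volume, but the space is a single point and `τ = 0`.
    · simp [LiftBound.mixingTime_eq_zero_of_subsingleton]
    · have : NeZero d := ⟨hd.ne'⟩
      exact h.liftConst_mul_mixingTime_le hΩ hball hK' hl
  · rcases Nat.eq_zero_or_pos d with rfl | hd
    · simp [LiftBound.mixingTime_eq_zero_of_subsingleton]
    · have : NeZero d := ⟨hd.ne'⟩
      have := LiftBound.nullSingletonClass_unitAddCircle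
      exact h.liftConst_mul_mixingTime_le hΩ hball hK' hl
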